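/- Let $K$ be a field of characteristic zero and let $L$ be a Lie algebra over $K$ (of arbitrary dimension). For a subset $X \subseteq L$ let $C_L(X) = \{y \in L : [y,x]=0 \text{ for all } x\in X\}$ be its centralizer. Suppose that $L$ satisfies the chain condition $\mathfrak{M}_c$ on centralizers, that is, there is no infinite strictly descending and no infinite strictly ascending chain of centralizers of subsets of $L$. Suppose moreover that $L$ is ad-nilpotent: for every $x \in L$ there is an integer $n \ge 0$ (possibly depending on $x$) such that $\operatorname{ad}_x^n(L) = 0$, where $\operatorname{ad}_x(y)=[x,y]$. Then $L$ is nilpotent, that is, its lower central series reaches $0$ after finitely many steps. -/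

import Mathlib

/-- The centralizer of a subset `X` of a Lie ring `L`: all `y` in `L` such that
`⁅y, x⁆ = 0` for every `x` in `X`. -/
def lieCentralizer {L : Type*} [LieRing L] (X : Set L) : Set L :=
  {y : L | ∀ x ∈ X, ⁅y, x⁆ = 0}

/-- The chain condition on centralizers (the class `𝔐_c`): there is no infinite strictly
descending and no infinite strictly ascending chain of centralizers of subsets of `L`. -/
def CentralizerChainCondition (L : Type*) [LieRing L] : Prop :=
  (¬ ∃ X : ℕ → Set L, StrictAnti fun n => lieCentralizer (X n)) ∧
    (¬ ∃ X : ℕ → Set L, StrictMono fun n => lieCentralizer (X n))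

/-- A Lie algebra is ad-nilpotent if `ad x` is nilpotent for each of its elements `x`
(the exponent may depend on `x`). -/
def IsAdNilpotent (K L : Type*) [Field K] [LieRing L] [LieAlgebra K L] : Prop :=
  ∀ x : L, ∃ n : ℕ, ∀ y : L, ((LieAlgebra.ad K L x) ^ n) y = 0

section LieRing

variable {L : Type*} [LieRing L]

/-! By the Engel condition, a set acting nilpotently still does after adjoining an element that
brackets it into itself. The chain condition makes this global. The heart is
`ActsNilpotently.of_lie_mem`: nilpotent action passes from `J` to `H ⊇ J` when all brackets of `H`
lie in `J`. `actsNilpotently_lieCent` then treats every centralizer by induction on smaller ones. By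
Zorn, a non-abelian one contains a maximal bracket-closed set acting nilpotently; were it proper, an
element normalising it could be adjoined. Chains have upper bounds because their union is abelian
modulo its intersection with a smaller centralizer. Finally, `L` is the centralizer of `∅`. -/

/-- The additive subgroup of all `v` in `L` with `⁅v, n⁆ ∈ U` for every `n ∈ N`. -/
def lieTransporter (N : Set L) (U : AddSubgroup L) : AddSubgroup L where
  carrier := {v | ∀ n ∈ N, ⁅v, n⁆ ∈ U}
  zero_mem' n _ := by simp
  add_mem' ha hb n hn := by
    rw [add_lie]
    exact U.add_mem (ha n hn) (hb n hn)
  neg_mem' ha n hn := by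
    rw [neg_lie]
    exact U.neg_mem (ha n hn)

/-- The centralizer of a subset of a Lie ring, as an additive subgroup. -/
def lieCent (X : Set L) : AddSubgroup L :=
  lieTransporter X ⊥

theorem mem_lieCent {X : Set L} {v : L} : v ∈ lieCent X ↔ ∀ x ∈ X, ⁅v, x⁆ = 0 :=
  Iff.rfl

/-- All sufficiently long products `⁅⁅⁅v, n₁⁆, n₂⁆, …⁆` with factors `nᵢ ∈ N` vanish. -/
def ActsNilpotently (N : Set L) : Prop :=
  ∃ k : ℕ, (lieTransporter N)^[k] ⊥ = ⊤

/-- Every `ad x` is nilpotent. -/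
def IsLeftEngel (L : Type*) [LieRing L] : Prop :=
  ∀ x : L, ∃ n : ℕ, ∀ v : L, (fun v => ⁅v, x⁆)^[n] v = 0

/-! ### Transporters and nilpotent action -/

theorem lie_lie_right_comm (a b c : L) : ⁅⁅a, b⁆, c⁆ = ⁅⁅a, c⁆, b⁆ + ⁅a, ⁅b, c⁆⁆ := by
  rw [leibniz_lie a b c, ← lie_skew ⁅a, c⁆ b]
  abel

theorem lieTransporter_mono_right (N : Set L) : Monotone (lieTransporter N) :=
  fun _ _ h _ hv n hn => h (hv n hn)

theorem lieTransporter_anti_left {M N : Set L} (h : M ⊆ N) (U : AddSubgroup L) :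
    lieTransporter N U ≤ lieTransporter M U :=
  fun _ hv n hn => hv n (h hn)

theorem lieCent_anti {X Y : Set L} (h : X ⊆ Y) : lieCent Y ≤ lieCent X :=
  lieTransporter_anti_left h ⊥

theorem mem_lieCent_union {X Y : Set L} {v : L} :
    v ∈ lieCent (X ∪ Y) ↔ v ∈ lieCent X ∧ v ∈ lieCent Y := by
  simp only [mem_lieCent, Set.mem_union, or_imp, forall_and]

theorem lieTransporter_iterate_anti_left {M N : Set L} (h : M ⊆ N) (U : AddSubgroup L) (k : ℕ) :
    (lieTransporter N)^[k] U ≤ (lieTransporter M)^[k] U := by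
  induction k with
  | zero => exact le_rfl
  | succ k ih =>
    rw [Function.iterate_succ_apply', Function.iterate_succ_apply']
    exact (lieTransporter_anti_left h _).trans (lieTransporter_mono_right M ih)

theorem ActsNilpotently.mono {M N : Set L} (hN : ActsNilpotently N) (h : M ⊆ N) :
    ActsNilpotently M := by
  obtain ⟨k, hk⟩ := hN
  exact ⟨k, top_le_iff.1 (hk ▸ lieTransporter_iterate_anti_left h ⊥ k)⟩

theorem lieTransporter_closure (N : Set L) (U : AddSubgroup L) :
    lieTransporter (AddSubgroup.closure N : Set L) U = lieTransporter N U := by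
  refine le_antisymm (lieTransporter_anti_left AddSubgroup.subset_closure U) fun v hv n hn => ?_
  induction hn using AddSubgroup.closure_induction with
  | mem x hx => exact hv x hx
  | zero => simp
  | add x y _ _ hx hy =>
    rw [lie_add]
    exact U.add_mem hx hy
  | neg x _ hx =>
    rw [lie_neg]
    exact U.neg_mem hx

theorem ActsNilpotently.closure {N : Set L} (hN : ActsNilpotently N) :
    ActsNilpotently (AddSubgroup.closure N : Set L) := by
  have h : lieTransporter (AddSubgroup.closure N : Set L) = lieTransporter N :=
    funext (lieTransporter_closure N)
  rwa [ActsNilpotently, h]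

theorem lie_mem_closure {N : Set L} (hN : ∀ a ∈ N, ∀ b ∈ N, ⁅a, b⁆ ∈ N) {a b : L}
    (ha : a ∈ AddSubgroup.closure N) (hb : b ∈ AddSubgroup.closure N) :
    ⁅a, b⁆ ∈ AddSubgroup.closure N := by
  have h : a ∈ lieTransporter (AddSubgroup.closure N : Set L) (AddSubgroup.closure N) := by
    rw [lieTransporter_closure]
    refine (AddSubgroup.closure_le _).2 (fun x hx y hy => ?_) ha
    exact AddSubgroup.subset_closure (hN x hx y hy)
  exact h b hb

/-- If `N` acts nilpotently, an `N`-stable set not contained in `U` has an element outside `U`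
that `N` maps into `U`. -/
theorem ActsNilpotently.exists_lie_mem {N : Set L} (hN : ActsNilpotently N) {W : Set L}
    (hW : ∀ w ∈ W, ∀ n ∈ N, ⁅w, n⁆ ∈ W) {U : AddSubgroup L} (hWU : ¬ W ⊆ U) :
    ∃ w ∈ W, w ∉ U ∧ ∀ n ∈ N, ⁅w, n⁆ ∈ U := by
  obtain ⟨k, hk⟩ := hN
  obtain ⟨w, hw, hwU⟩ := Set.not_subset.1 hWU
  have hwk : w ∈ (lieTransporter N)^[k] U :=
    (lieTransporter_mono_right N).iterate k bot_le (hk ▸ AddSubgroup.mem_top w)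
  clear hk
  induction k generalizing w with
  | zero => exact absurd hwk hwU
  | succ k ih =>
    rw [Function.iterate_succ_apply'] at hwk
    by_cases h : ∀ n ∈ N, ⁅w, n⁆ ∈ U
    · exact ⟨w, hw, hwU, h⟩
    · push Not at h
      obtain ⟨n, hn, hnU⟩ := h
      exact ih _ (hW w hw n hn) hnU (hwk n hn)

/-- The iterated transporters of `E` are `l`-stable and `E` kills each factor of this filtration.
Only `l` acts there, with exponent `n`, so `n * k` steps suffice. -/
theorem ActsNilpotently.insert_of_lie_mem (had : IsLeftEngel L) {E : Set L} (hE : ActsNilpotently E) {l : L}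
    (hl : ∀ e ∈ E, ⁅l, e⁆ ∈ E) : ActsNilpotently (insert l E) := by
  obtain ⟨k, hk⟩ := hE
  obtain ⟨n, hn⟩ := had l
  have stable : ∀ i, ∀ v ∈ (lieTransporter E)^[i] ⊥, ⁅v, l⁆ ∈ (lieTransporter E)^[i] ⊥ := by
    intro i
    induction i with
    | zero =>
      intro v hv
      obtain rfl : v = 0 := hv
      simp
    | succ i ih =>
      intro v hv
      rw [Function.iterate_succ_apply'] at hv ⊢
      intro e he
      rw [lie_lie_right_comm]
      exact AddSubgroup.add_mem _ (ih _ (hv e he)) (hv _ (hl e he))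
  have le_self : ∀ (U : AddSubgroup L), (∀ v ∈ U, ∀ e ∈ insert l E, ⁅v, e⁆ ∈ U) → ∀ j : ℕ,
      U ≤ (lieTransporter (insert l E))^[j] U := by
    intro U hU j
    induction j with
    | zero => exact le_rfl
    | succ j ih =>
      rw [Function.iterate_succ_apply']
      exact fun v hv e he => ih (hU v hv e he)
  have antitone : ∀ i, (lieTransporter E)^[i] ⊥ ≤ (lieTransporter E)^[i + 1] (⊥ : AddSubgroup L) :=
    fun i => (lieTransporter_mono_right E).iterate i bot_le
  have step : ∀ i, (lieTransporter E)^[i + 1] ⊥ ≤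
      (lieTransporter (insert l E))^[n] ((lieTransporter E)^[i] (⊥ : AddSubgroup L)) := by
    intro i
    have key : ∀ j, ∀ v ∈ (lieTransporter E)^[i + 1] ⊥, (fun v => ⁅v, l⁆)^[j] v = 0 →
        v ∈ (lieTransporter (insert l E))^[j] ((lieTransporter E)^[i] (⊥ : AddSubgroup L)) := by
      intro j
      induction j with
      | zero =>
        intro v _ h0
        obtain rfl : v = 0 := h0
        exact zero_mem _
      | succ j ih =>
        intro v hv h0
        rw [Function.iterate_succ_apply']
        rintro e (rfl | he)
        · exact ih _ (stable _ _ hv) h0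
        · refine le_self _ ?_ j ?_
          · rintro w hw e (rfl | he)
            · exact stable _ _ hw
            · have := antitone i hw
              rw [Function.iterate_succ_apply'] at this
              exact this e he
          · rw [Function.iterate_succ_apply'] at hv
            exact hv e he
    exact fun v hv => key n v hv (hn v)
  have final : ∀ i, (lieTransporter E)^[i] ⊥ ≤
      (lieTransporter (insert l E))^[n * i] (⊥ : AddSubgroup L) := by
    intro i
    induction i with
    | zero => exact le_rfl
    | succ i ih =>
      rw [show n * (i + 1) = n + n * i by ring, Function.iterate_add_apply _ n]
      exact (step i).trans ((lieTransporter_mono_right _).iterate n ih)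
  exact ⟨n * k, top_le_iff.1 (hk ▸ final k)⟩

/-! ### Criteria under the chain condition -/

theorem CentralizerChainCondition.wellFounded_lt (hL : CentralizerChainCondition L) :
    WellFounded fun X Y : Set L => lieCent X < lieCent Y := by
  refine wellFounded_iff_isEmpty_descending_chain.2 ⟨fun ⟨f, hf⟩ => hL.1 ⟨f, ?_⟩⟩
  exact strictAnti_nat_of_succ_lt fun n => SetLike.coe_ssubset_coe.2 (hf n)

theorem CentralizerChainCondition.wellFounded_gt (hL : CentralizerChainCondition L) :
    WellFounded fun X Y : Set L => lieCent Y < lieCent X := by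
  refine wellFounded_iff_isEmpty_descending_chain.2 ⟨fun ⟨f, hf⟩ => hL.2 ⟨f, ?_⟩⟩
  exact strictMono_nat_of_lt_succ fun n => SetLike.coe_ssubset_coe.2 (hf n)

/-- Take a finite subset with minimal centralizer: adjoining another element of `X` cannot shrink
it. -/
theorem CentralizerChainCondition.exists_finite_subset (hL : CentralizerChainCondition L)
    (X : Set L) : ∃ F ⊆ X, F.Finite ∧ lieCent F = lieCent X := by
  obtain ⟨F, ⟨hFX, hF⟩, hmin⟩ := hL.wellFounded_lt.has_min {F : Set L | F ⊆ X ∧ F.Finite}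
    ⟨∅, Set.empty_subset X, Set.finite_empty⟩
  refine ⟨F, hFX, hF, le_antisymm (fun v hv x hx => ?_) (lieCent_anti hFX)⟩
  have hle : lieCent (insert x F) ≤ lieCent F := lieCent_anti (Set.subset_insert x F)
  have heq := hle.eq_of_not_lt (hmin _ ⟨Set.insert_subset hx hFX, hF.insert x⟩)
  exact (heq ▸ hv : v ∈ lieCent (insert x F)) x (Set.mem_insert x F)

/-- The set `N` acts nilpotently on a Lie ring as soon as on every `N`-stable centralizer on which
it acts non-trivially some element of `N` acts non-trivially and commutes with the action. -/
theorem actsNilpotently_of_exists_central (hL : CentralizerChainCondition L) (had : IsLeftEngel L)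
    {N : Set L}
    (h : ∀ X : Set L, (∀ v ∈ lieCent X, ∀ n ∈ N, ⁅v, n⁆ ∈ lieCent X) → ¬ lieCent X ≤ lieCent N →
      ∃ x ∈ N, ¬ lieCent X ≤ lieCent {x} ∧ ∀ n ∈ N, lieCent X ≤ lieCent {⁅x, n⁆}) :
    ActsNilpotently N := by
  have main : ∀ X : Set L, (∀ v ∈ lieCent X, ∀ n ∈ N, ⁅v, n⁆ ∈ lieCent X) →
      ∃ k : ℕ, lieCent X ≤ (lieTransporter N)^[k] ⊥ := by
    intro X
    induction X using hL.wellFounded_lt.induction with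
    | _ X ih =>
    intro hX
    by_cases hXN : lieCent X ≤ lieCent N
    · exact ⟨1, hXN⟩
    obtain ⟨x, hxN, hx, hcomm⟩ := h X hX hXN
    -- Since `⁅·, x⁆` commutes with `N` on `lieCent X`, its kernel there is `N`-stable and smaller.
    -- Each power of this nilpotent map costs `m` further steps.
    have swap : ∀ v ∈ lieCent X, ∀ n ∈ N, ⁅⁅v, n⁆, x⁆ = ⁅⁅v, x⁆, n⁆ := by
      intro v hv n hn
      rw [lie_lie_right_comm v x n, hcomm n hn hv _ rfl, add_zero]
    obtain ⟨m, hm⟩ := ih (X ∪ {x}) (lt_of_le_not_ge (lieCent_anti Set.subset_union_left)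
      fun hle => hx (hle.trans (lieCent_anti Set.subset_union_right))) (by
        intro v hv n hn
        rw [mem_lieCent_union] at hv ⊢
        refine ⟨hX v hv.1 n hn, ?_⟩
        rintro _ rfl
        rw [swap v hv.1 n hn, hv.2 _ rfl, zero_lie]
        exact zero_mem _)
    have lift : ∀ i : ℕ, ∀ v ∈ lieCent X,
        ⁅v, x⁆ ∈ (lieTransporter N)^[i] ⊥ → v ∈ (lieTransporter N)^[i] (lieCent (X ∪ {x})) := by
      intro i
      induction i with
      | zero =>
        intro v hv h0
        refine mem_lieCent_union.2 ⟨hv, ?_⟩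
        rintro _ rfl
        exact h0
      | succ i ih =>
        intro v hv h0
        rw [Function.iterate_succ_apply'] at h0 ⊢
        intro n hn
        refine ih _ (hX v hv n hn) ?_
        rw [swap v hv n hn]
        exact h0 n hn
    have key : ∀ j, ∀ v ∈ lieCent X, (fun v => ⁅v, x⁆)^[j] v = 0 →
        v ∈ (lieTransporter N)^[j * m] (⊥ : AddSubgroup L) := by
      intro j
      induction j with
      | zero =>
        intro v _ h0
        obtain rfl : v = 0 := h0
        exact zero_mem _
      | succ j ih =>
        intro v hv h0
        have h1 := lift _ v hv (ih _ (hX v hv x hxN) h0)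
        rw [add_mul, one_mul, Function.iterate_add_apply]
        exact (lieTransporter_mono_right N).iterate _ hm h1
    obtain ⟨n, hn⟩ := had x
    exact ⟨n * m, fun v hv => key n v hv (hn v)⟩
  obtain ⟨k, hk⟩ := main ∅ (fun v _ n _ => mem_lieCent.2 (by simp))
  exact ⟨k, top_le_iff.1 fun v _ => hk (mem_lieCent.2 (by simp))⟩

/-- An extension of a nilpotently acting ideal `J` by an abelian quotient acts nilpotently, if
the centralizers of `J` and of the whole agree. -/
theorem actsNilpotently_of_lieCent_eq (hL : CentralizerChainCondition L) (had : IsLeftEngel L)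
    {H J : Set L} (hJH : J ⊆ H) (hHJ : ∀ a ∈ H, ∀ b ∈ H, ⁅a, b⁆ ∈ J) (hJ : ActsNilpotently J)
    (hcent : lieCent J = lieCent H)
    (hfin : ∀ F ⊆ H, F.Finite → ActsNilpotently (F ∪ J)) : ActsNilpotently H := by
  refine actsNilpotently_of_exists_central hL had fun X hX hXH => ?_
  have kill : ∀ {n : L}, (∀ v ∈ lieCent X, ⁅v, n⁆ = 0) → ∀ h ∈ H,
      ∀ v ∈ lieCent X, ⁅v, ⁅n, h⁆⁆ = 0 := by
    intro n hn h hh v hv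
    have := lie_lie_right_comm v n h
    rwa [hn v hv, hn _ (hX v hv h hh), zero_lie, zero_add, eq_comm] at this
  -- `Y` makes `lieCent (X ∪ Y)` maximal. A candidate exists because `J` acts nilpotently on itself
  -- modulo the elements killing `lieCent X`.
  obtain ⟨Y, ⟨hYJ, hYkill, hYH, hYX⟩, hmax⟩ :=
    (InvImage.wf (fun Y : Set L => X ∪ Y) hL.wellFounded_gt).has_min
    {Y : Set L | Y ⊆ J ∧ (∀ y ∈ Y, ∀ j ∈ J, ∀ v ∈ lieCent X, ⁅v, ⁅y, j⁆⁆ = 0) ∧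
      (∀ y ∈ Y, ∀ h ∈ H, ⁅y, h⁆ ∈ Y) ∧ ∃ y ∈ Y, ¬ lieCent X ≤ lieCent {y}} (by
    refine ⟨{n ∈ J | ∀ j ∈ J, ∀ v ∈ lieCent X, ⁅v, ⁅n, j⁆⁆ = 0}, fun n hn => hn.1,
      fun n hn => hn.2, fun n hn h hh => ⟨hHJ n (hJH hn.1) h hh, fun j hj v hv => ?_⟩, ?_⟩
    · rw [lie_lie_right_comm n h j, lie_add, kill (hn.2 j hj) h hh v hv,
        hn.2 _ (hHJ h hh j (hJH hj)) v hv, add_zero]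
    · rw [← hcent] at hXH
      obtain ⟨w, hwJ, hw, hwn⟩ := hJ.exists_lie_mem (W := J) (U := lieCent (lieCent X))
        (fun a ha b hb => hHJ a (hJH ha) b (hJH hb)) (fun hsub => hXH fun v hv j hj => by
          change ⁅v, j⁆ = 0
          rw [← lie_skew, hsub hj v hv, neg_zero])
      refine ⟨w, ⟨hwJ, fun j hj v hv => ?_⟩, fun hle => hw fun v hv => ?_⟩
      · rw [← lie_skew, hwn j hj v hv, neg_zero]
      · change ⁅w, v⁆ = 0
        rw [← lie_skew, hle hv w rfl, neg_zero])
  obtain ⟨y₀, hy₀, hy₀X⟩ := hYX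
  by_cases hcase : ∀ y ∈ Y, ∀ h ∈ H, lieCent X ≤ lieCent {⁅y, h⁆}
  · exact ⟨y₀, hJH (hYJ hy₀), hy₀X, hcase y₀ hy₀⟩
  push Not at hcase
  obtain ⟨y₁, hy₁, h₁, hh₁, hne⟩ := hcase
  exfalso
  -- `Y'` competes with `Y`, so by maximality both have the same centralizer in `lieCent X`;
  -- finitely many `h ∈ H` suffice to detect it.
  set Y' : Set L := Set.image2 (fun y h => ⁅y, h⁆) Y H with hY'
  have hY'Y : Y' ⊆ Y := Set.image2_subset_iff.2 hYH
  have hle : lieCent (X ∪ Y) ≤ lieCent (X ∪ Y') :=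
    lieCent_anti (Set.union_subset_union_right X hY'Y)
  have heq : lieCent (X ∪ Y) = lieCent (X ∪ Y') := hle.eq_of_not_lt (hmax Y'
    ⟨hY'Y.trans hYJ, fun y hy => hYkill y (hY'Y hy),
      fun y hy h hh => Set.mem_image2_of_mem (hY'Y hy) hh,
      _, Set.mem_image2_of_mem hy₁ hh₁, hne⟩)
  obtain ⟨F, hFY', hF, hFcent⟩ := hL.exists_finite_subset Y'
  have hex : ∀ f ∈ F, ∃ h ∈ H, ∃ y ∈ Y, ⁅y, h⁆ = f := fun f hf => by
    obtain ⟨y, hy, h, hh, rfl⟩ := hFY' hf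
    exact ⟨h, hh, y, hy, rfl⟩
  choose! g hgH hg using hex
  have hG : ActsNilpotently (g '' F ∪ J) :=
    hfin _ (Set.image_subset_iff.2 hgH) (hF.image g)
  have hGH : g '' F ∪ J ⊆ H := Set.union_subset (Set.image_subset_iff.2 hgH) hJH
  obtain ⟨v, hv, hvU, hvG⟩ := hG.exists_lie_mem (W := lieCent X) (U := lieCent (X ∪ Y))
    (fun w hw n hn => hX w hw n (hGH hn)) fun hsub => hy₀X fun w hw => by
      rintro _ rfl
      exact (mem_lieCent_union.1 (hsub hw)).2 _ hy₀
  -- `⁅v, y⁆` centralizes `J`, hence `H`. By Jacobi `v` then kills `F`, so it centralizes `Y` after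
  -- all.
  have hvY : ∀ y ∈ Y, ⁅v, y⁆ ∈ lieCent H := by
    intro y hy
    rw [← hcent]
    intro j hj
    rw [lie_lie_right_comm, hYkill y hy j hj v hv, add_zero,
      (mem_lieCent_union.1 (hvG j (Or.inr hj))).2 y hy]
    exact zero_mem _
  refine hvU (heq ▸ mem_lieCent_union.2 ⟨hv, hFcent ▸ fun f hf => ?_⟩)
  obtain ⟨y, hy, hyf⟩ := hg f hf
  have h1 := lie_lie_right_comm v y (g f)
  rw [hyf, hvY y hy _ (hgH f hf),
    (mem_lieCent_union.1 (hvG _ (Or.inl (Set.mem_image_of_mem g hf)))).2 y hy, zero_add] at h1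
  exact h1.symm

/-- An extension of a nilpotently acting ideal by an abelian quotient acts nilpotently. -/
theorem ActsNilpotently.of_lie_mem (hL : CentralizerChainCondition L) (had : IsLeftEngel L)
    {H J : Set L} (hJH : J ⊆ H) (hHJ : ∀ a ∈ H, ∀ b ∈ H, ⁅a, b⁆ ∈ J) (hJ : ActsNilpotently J) :
    ActsNilpotently H := by
  have hfin : ∀ F ⊆ H, F.Finite → ActsNilpotently (F ∪ J) := by
    intro F hFH hF
    induction F, hF using Set.Finite.induction_on with
    | empty => rwa [Set.empty_union]
    | @insert a F _ _ ih =>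
      rw [Set.insert_union]
      have hF' : F ⊆ H := (Set.subset_insert a F).trans hFH
      exact (ih hF').insert_of_lie_mem had fun e he =>
        Or.inr (hHJ a (hFH (Set.mem_insert a F)) e (Set.union_subset hF' hJH he))
  -- Absorbing `F` into `J` makes the two centralizers agree.
  obtain ⟨F, hFH, hF, hFcent⟩ := hL.exists_finite_subset H
  have hFJ : F ∪ J ⊆ H := Set.union_subset hFH hJH
  refine actsNilpotently_of_lieCent_eq hL had hFJ (fun a ha b hb => Or.inr (hHJ a ha b hb))
    (hfin F hFH hF) (le_antisymm ?_ (lieCent_anti hFJ)) fun G hGH hG => ?_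
  · rw [← hFcent]
    exact lieCent_anti Set.subset_union_left
  · rw [← Set.union_assoc]
    exact hfin _ (Set.union_subset hGH hFH) (hG.union hF)

/-! ### Centralizers act nilpotently -/

theorem lie_mem_lieCent {X : Set L} {a b : L} (ha : a ∈ lieCent X) (hb : b ∈ lieCent X) :
    ⁅a, b⁆ ∈ lieCent X := by
  intro x hx
  rw [lie_lie_right_comm, ha x hx, hb x hx, zero_lie, lie_zero, add_zero]
  exact zero_mem _

/-- If all smaller centralizers act nilpotently, then the union of a chain of nilpotently acting
bracket-closed subsets of a non-abelian centralizer acts nilpotently. -/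
theorem actsNilpotently_sUnion (hL : CentralizerChainCondition L) (had : IsLeftEngel L)
    {X : Set L} (ih : ∀ Y : Set L, lieCent Y < lieCent X → ActsNilpotently (lieCent Y : Set L))
    (hX : ¬ lieCent X ≤ lieCent (lieCent X)) {c : Set (Set L)}
    (hc : ∀ N ∈ c, N ⊆ lieCent X ∧ (∀ a ∈ N, ∀ b ∈ N, ⁅a, b⁆ ∈ N) ∧ ActsNilpotently N)
    (hchain : IsChain (· ⊆ ·) c) (hne : c.Nonempty) : ActsNilpotently (⋃₀ c) := by
  set Z : AddSubgroup L := lieCent (X ∪ lieCent X) with hZ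
  -- `V N` shrinks as `N` grows, so its centralizer stabilises at some `N₀`. It is smaller than
  -- `lieCent X` because `V N₀` is not contained in the centre `Z`, and by Jacobi brackets of
  -- elements of `N` centralize `V N`.
  let V : Set L → Set L := fun N => {v | v ∈ lieCent X ∧ ∀ n ∈ N, ⁅v, n⁆ ∈ Z}
  obtain ⟨N₀, hN₀, hmax⟩ := (InvImage.wf (fun N => X ∪ V N) hL.wellFounded_gt).has_min c hne
  have hlt : lieCent (X ∪ V N₀) < lieCent X := by
    refine lt_of_le_not_ge (lieCent_anti Set.subset_union_left) fun hle => ?_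
    obtain ⟨hN₀X, -, hN₀nil⟩ := hc N₀ hN₀
    obtain ⟨w, hw, hwZ, hwN⟩ := hN₀nil.exists_lie_mem (W := lieCent X) (U := Z)
      (fun a ha b hb => lie_mem_lieCent ha (hN₀X hb))
      fun hsub => hX fun v hv => (mem_lieCent_union.1 (hsub hv)).2
    refine hwZ (mem_lieCent_union.2 ⟨hw, fun v hv => ?_⟩)
    change ⁅w, v⁆ = 0
    rw [← lie_skew, (mem_lieCent_union.1 (hle hv)).2 w ⟨hw, hwN⟩, neg_zero]
  have hstable : ∀ N ∈ c, N₀ ⊆ N → lieCent (X ∪ V N) = lieCent (X ∪ V N₀) := by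
    intro N hN hsub
    have hle : lieCent (X ∪ V N₀) ≤ lieCent (X ∪ V N) :=
      lieCent_anti (Set.union_subset_union_right X fun v hv => ⟨hv.1, fun n hn => hv.2 n (hsub hn)⟩)
    exact (hle.eq_of_not_lt (hmax N hN)).symm
  have hsub2 : ∀ a ∈ ⋃₀ c, ∀ b ∈ ⋃₀ c, ∃ N ∈ c, N₀ ⊆ N ∧ a ∈ N ∧ b ∈ N := by
    rintro a ⟨A, hA, ha⟩ b ⟨B, hB, hb⟩
    obtain ⟨M, hM, hAM, hBM⟩ := hchain.directedOn A hA B hB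
    obtain ⟨N, hN, hMN, hN₀N⟩ := hchain.directedOn M hM N₀ hN₀
    exact ⟨N, hN, hN₀N, hMN (hAM ha), hMN (hBM hb)⟩
  refine ActsNilpotently.of_lie_mem hL had (J := ⋃₀ c ∩ lieCent (X ∪ V N₀))
    Set.inter_subset_left (fun a ha b hb => ?_) ((ih _ hlt).mono Set.inter_subset_right)
  obtain ⟨N, hN, hN₀N, haN, hbN⟩ := hsub2 a ha b hb
  obtain ⟨hNX, hNclosed, -⟩ := hc N hN
  refine ⟨⟨N, hN, hNclosed a haN b hbN⟩, ?_⟩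
  rw [← hstable N hN hN₀N]
  refine mem_lieCent_union.2 ⟨hNX (hNclosed a haN b hbN), fun v hv => ?_⟩
  have hzero : ∀ {m n : L}, m ∈ N → n ∈ N → ⁅⁅v, m⁆, n⁆ = 0 := fun hm hn =>
    (mem_lieCent_union.1 (hv.2 _ hm)).2 _ (hNX hn)
  have h1 := lie_lie_right_comm v a b
  rw [hzero haN hbN, hzero hbN haN, zero_add] at h1
  change ⁅⁅a, b⁆, v⁆ = 0
  rw [← lie_skew, ← h1, neg_zero]

theorem actsNilpotently_lieCent (hL : CentralizerChainCondition L) (had : IsLeftEngel L)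
    (X : Set L) : ActsNilpotently (lieCent X : Set L) := by
  induction X using hL.wellFounded_lt.induction with
  | _ X ih =>
  by_cases hX : lieCent X ≤ lieCent (lieCent X)
  -- In the abelian case any `x` acting non-trivially meets the criterion.
  · refine actsNilpotently_of_exists_central hL had fun Y _ hYX => ?_
    obtain ⟨v, hv, hvX⟩ := SetLike.not_le_iff_exists.1 hYX
    obtain ⟨x, hx, hvx⟩ : ∃ x ∈ (lieCent X : Set L), ⁅v, x⁆ ≠ 0 := by
      by_contra! hcon
      exact hvX hcon
    refine ⟨x, hx, fun hle => hvx (hle hv x rfl), fun n hn w _ => ?_⟩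
    rintro _ rfl
    rw [hX hx n hn, lie_zero]
    exact zero_mem _
  obtain ⟨N, ⟨hNX, hNclosed, hNnil⟩, hmax⟩ := zorn_subset
    {N : Set L | N ⊆ lieCent X ∧ (∀ a ∈ N, ∀ b ∈ N, ⁅a, b⁆ ∈ N) ∧ ActsNilpotently N} (by
    intro c hc hchain
    rcases c.eq_empty_or_nonempty with rfl | hne
    · refine ⟨∅, ⟨Set.empty_subset _, by simp, 1, top_le_iff.1 fun v _ n hn => ?_⟩, by simp⟩
      exact absurd hn (Set.notMem_empty n)
    · refine ⟨⋃₀ c, ⟨Set.sUnion_subset fun N hN => (hc hN).1, ?_,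
        actsNilpotently_sUnion hL had ih hX hc hchain hne⟩, fun N => Set.subset_sUnion_of_mem⟩
      rintro a ⟨A, hA, ha⟩ b ⟨B, hB, hb⟩
      obtain ⟨M, hM, hAM, hBM⟩ := hchain.directedOn A hA B hB
      exact ⟨M, hM, (hc hM).2.1 a (hAM ha) b (hBM hb)⟩)
  -- Maximality makes `N` an additive subgroup, so one can work modulo `N`.
  have hclosure : (AddSubgroup.closure N : Set L) ⊆ N :=
    hmax ⟨(AddSubgroup.closure_le _).2 hNX, fun a ha b hb => lie_mem_closure hNclosed ha hb,
      hNnil.closure⟩ AddSubgroup.subset_closure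
  by_cases hXN : (lieCent X : Set L) ⊆ AddSubgroup.closure N
  · exact hNnil.mono (hXN.trans hclosure)
  obtain ⟨v, hv, hvN, hvn⟩ := hNnil.exists_lie_mem
    (fun a ha b hb => lie_mem_lieCent ha (hNX hb)) hXN
  refine absurd (AddSubgroup.subset_closure (hmax ⟨Set.insert_subset hv hNX, ?_,
    hNnil.insert_of_lie_mem had fun e he => hclosure (hvn e he)⟩ (Set.subset_insert v N)
    (Set.mem_insert v N))) hvN
  rintro a (rfl | ha) b (rfl | hb)
  · rw [lie_self]
    exact Or.inr (hclosure (zero_mem _))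
  · exact Or.inr (hclosure (hvn b hb))
  · rw [← lie_skew]
    exact Or.inr (hclosure (neg_mem (hvn a ha)))
  · exact Or.inr (hNclosed a ha b hb)

/-! ### From nilpotent action to nilpotency -/

theorem isNilpotent_of_actsNilpotently (h : ActsNilpotently (Set.univ : Set L)) :
    LieRing.IsNilpotent L := by
  rw [LieRing.IsNilpotent, LieModule.isNilpotent_iff_exists_ucs_eq_top ℤ]
  obtain ⟨k, hk⟩ := h
  -- Iterated transporters of the whole ring lie in the upper central series.
  have hle : ∀ i, ∀ v ∈ (lieTransporter (Set.univ : Set L))^[i] ⊥,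
      v ∈ (⊥ : LieSubmodule ℤ L L).ucs i := by
    intro i
    induction i with
    | zero => exact fun v hv => hv
    | succ i ih =>
      intro v hv
      rw [Function.iterate_succ_apply'] at hv
      rw [LieSubmodule.ucs_succ, LieSubmodule.mem_normalizer]
      intro x
      rw [← lie_skew]
      exact neg_mem (ih _ (hv x (Set.mem_univ x)))
  exact ⟨k, top_le_iff.1 fun v _ => hle k v (hk ▸ AddSubgroup.mem_top v)⟩

end LieRing

theorem IsAdNilpotent.isLeftEngel {K L : Type*} [Field K] [LieRing L] [LieAlgebra K L]
    (had : IsAdNilpotent K L) : IsLeftEngel L := by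
  intro x
  obtain ⟨n, hn⟩ := had x
  have key : ∀ i v, (LieAlgebra.ad K L x ^ i) v = 0 → (fun v : L => ⁅v, x⁆)^[i] v = 0 := by
    intro i
    induction i with
    | zero => exact fun v hv => hv
    | succ i ih =>
      intro v hv
      rw [pow_succ, Module.End.mul_apply, LieAlgebra.ad_apply] at hv
      refine ih _ ?_
      change (LieAlgebra.ad K L x ^ i) ⁅v, x⁆ = 0
      rw [← lie_skew, map_neg, hv, neg_zero]
  exact ⟨n, fun v => key n v (hn v)⟩

theorem mainTheorem2 (K : Type*) [Field K] [CharZero K]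
    (L : Type*) [LieRing L] [LieAlgebra K L]
    (hL : CentralizerChainCondition L) (had : IsAdNilpotent K L) :
    LieRing.IsNilpotent L := by
  have h := actsNilpotently_lieCent hL had.isLeftEngel ∅
  refine isNilpotent_of_actsNilpotently (h.mono fun v _ => ?_)
  exact mem_lieCent.2 (by simp)
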